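/- Let $E$ be a (real) Banach lattice with positive cone $E^+$ and norm dual $E'$, let $Y$ be a real Banach space, and let $T:E\to Y$ be a bounded linear operator. A net $(x_\alpha)$ in $E$ is uaw-convergent to $x\in E$ (written $x_\alpha\xrightarrow{uaw}x$) if $|x_\alpha-x|\wedge u\to 0$ weakly for every $u\in E^+$. A set $A\subset E$ is uaw-compact (respectively relatively uaw-compact) if every net in $A$ has a subnet that is uaw-convergent to a point of $A$ (respectively to a point of $E$). For $S\subset E$ let $\mathrm{sol}(S)=\{x\in E:\exists\, y\in S,\ |x|\le|y|\}$; for norm bounded $S$, the operator $T$ is called $S$-L-weakly compact if $\|T(x_n)\|\to0$ for every sequence $(x_n)\subset \mathrm{sol}(S)$ with $x_n\xrightarrow{uaw}0$. The operator $T$ is order weakly compact if $T([0,v])$ is relatively weakly compact in $Y$ for every $v\in E^+$. The following statements are equivalent: 1. $T$ is order weakly compact. 2. For every relatively compact subset $S$ of $E$, the operator $T$ is $S$-L-weakly compact. 3. For every $v\in E^+$, the operator $T$ is $\{v\}$-L-weakly compact. 4. For every $\varepsilon>0$ and $v\in E^+$ there exist a positive functional $g\in E'$ and $u\in E^+$ such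 that $\|T(x)\|\le g(|x|\wedge u)+\varepsilon$ for every $x\in[-v,v]$. 5. For every $v\in E^+$ and every net $(x_\alpha)\subset[-v,v]$ with $x_\alpha\xrightarrow{uaw}0$, one has $\|T(x_\alpha)\|\to0$. 6. For every $v\in E^+$ and every sequence $(x_n)\subset[-v,v]$ with $x_n\xrightarrow{uaw}0$, one has $\|T(x_n)\|\to0$. 7. For every order bounded uaw-compact subset $A$ of $E$, the set $T(A)$ is compact. 8. For every order bounded relatively uaw-compact subset $A$ of $E$, the set $T(A)$ is relatively compact. -/

import Mathlib

open Filter Topology Set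

universe u v w

section UnboundedAbsoluteWeak

/- Banach lattices are real: a complete normed space with a vector lattice order and a solid norm. -/
variable {E : Type u} [NormedAddCommGroup E] [NormedSpace ℝ E] [Lattice E]

/-- Unbounded absolute weak convergence (uaw-convergence) of the family `x` to `a` along the
filter `l`: for each `u ≥ 0`, the family `|x i - a| ∧ u` converges weakly to zero.
For a net or a sequence, `l` is `atTop`. -/
def UawTendsto {ι : Type*} (x : ι → E) (l : Filter ι) (a : E) : Prop :=
  ∀ u : E, 0 ≤ u → Tendsto (fun i => toWeakSpace ℝ E (|x i - a| ⊓ u)) l (𝓝 0)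

/-- The net `x` in `E` has a subnet which is uaw-convergent to `a`. A subnet of `x : ι → E` is a
net `x ∘ φ`, where `φ : κ → ι` is a map from a directed set such that for every `i₀` one has
`i₀ ≤ φ k` for all large enough `k`. -/
def HasSubnetUawTendsto {ι : Type u} [Preorder ι] (x : ι → E) (a : E) : Prop :=
  ∃ (κ : Type u) (_ : Preorder κ) (_ : IsDirectedOrder κ) (_ : Nonempty κ) (φ : κ → ι),
    Tendsto φ atTop atTop ∧ UawTendsto (x ∘ φ) atTop a

/-- `A` is uaw-compact: every net in `A` has a subnet which is uaw-convergent to a point of `A`.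
(Directed sets in the universe of `E` are enough to detect compactness of a subset of `E`.) -/
def UawCompact (A : Set E) : Prop :=
  ∀ (ι : Type u) [Preorder ι] [IsDirectedOrder ι] [Nonempty ι] (x : ι → E), (∀ i, x i ∈ A) →
    ∃ a ∈ A, HasSubnetUawTendsto x a

/-- `A` is relatively uaw-compact: every net in `A` has a subnet which is uaw-convergent in `E`. -/
def RelativelyUawCompact (A : Set E) : Prop :=
  ∀ (ι : Type u) [Preorder ι] [IsDirectedOrder ι] [Nonempty ι] (x : ι → E), (∀ i, x i ∈ A) →
    ∃ a : E, HasSubnetUawTendsto x a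

/-- `A` is order bounded: it is contained in an order interval. -/
def OrderBounded (A : Set E) : Prop :=
  ∃ a b : E, A ⊆ Icc a b

variable {Y : Type*} [NormedAddCommGroup Y] [NormedSpace ℝ Y]

/-- `T` is order weakly compact: `T [0, v]` is relatively weakly compact in `Y` for all `v ≥ 0`. -/
def OrderWeaklyCompact (T : E →L[ℝ] Y) : Prop :=
  ∀ v : E, 0 ≤ v → IsCompact (closure (toWeakSpace ℝ Y '' (T '' Icc 0 v)))

/-- `T` is `S`-L-weakly compact (for a norm bounded set `S`): `T` maps every uaw-null sequence in
the solid hull `{x | ∃ y ∈ S, |x| ≤ |y|}` of `S` to a norm null sequence. -/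
def SLWeaklyCompact (S : Set E) (T : E →L[ℝ] Y) : Prop :=
  ∀ x : ℕ → E, (∀ n, x n ∈ LatticeOrderedAddCommGroup.solidClosure S) → UawTendsto x atTop 0 →
    Tendsto (fun n => T (x n)) atTop (𝓝 0)

end UnboundedAbsoluteWeak

/-!
All conditions are equivalent to `T` being dominated in norm by positive functionals on order
intervals, up to small errors. The link is the behaviour of `T` on order bounded series, that is,
on positive sequences `w` whose finite sums are bounded by some `v`.

* If `T` is order weakly compact, then `T (w n) → 0`. Otherwise, Rosenthal's lemma yields a
  subsequence and functionals `f n` with `f n (T (w n)) ≥ ε` that are small on the images of the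
  other terms. A weak cluster point `y` of the partial sums of `T (w n)` then has `f n y` large for
  all `n`, while Mazur's theorem approximates `y` in norm by points where `f n` is small for some
  `n`.
* If `T` is not almost dominated on `[0, v]`, one splits off a `w ∈ [0, v]` with `‖T w‖` bounded
  below such that `T` is still not almost dominated on `[0, v - w]`; iterating gives an order
  bounded series whose image does not tend to zero.
* If `T` is almost dominated by `g` on `[0, v]`, the function `x ↦ ∑ k ≤ n, g |x - k v / n|` is
  convex, uniformly so with respect to `x ↦ g |x|` up to an error `2 g v / n`. Hence near-minimizers
  in the convex members of a filter on `[0, v]` are almost unique, which places the weak* limits of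
  the filter's image under `T` in `Y` rather than just in its bidual.

Order bounded series are uaw-null, and a uaw-null sequence `x` in an order interval makes
`{0} ∪ {x n}` uaw-compact. So domination both follows from and implies the conditions on
uaw-convergence.
-/

section VectorLattice

variable {E : Type*} [AddCommGroup E] [Lattice E]

section Module

variable [Module ℝ E] [IsOrderedModule ℝ E]

theorem smul_sup_of_pos {c : ℝ} (hc : 0 < c) (x y : E) : c • (x ⊔ y) = c • x ⊔ c • y :=
  (OrderIso.smulRight hc).map_sup x y

theorem abs_smul_of_pos {c : ℝ} (hc : 0 < c) (x : E) : |c • x| = c • |x| := by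
  rw [abs, abs, smul_sup_of_pos hc, smul_neg]

end Module

variable [IsOrderedAddMonoid E]

theorem mem_Icc_neg_iff_abs_le {x v : E} : x ∈ Icc (-v) v ↔ |x| ≤ v := by
  rw [abs_le', neg_le, and_comm, mem_Icc]

theorem posPart_sub_le_of_le {x y z : E} (hz : 0 ≤ z) (h : x ≤ y + z) : (x - y)⁺ ≤ z :=
  sup_le (sub_le_iff_le_add'.2 h) hz

theorem posPart_sub_mem_Icc {x y : E} (hx : 0 ≤ x) (hy : 0 ≤ y) : (x - y)⁺ ∈ Icc 0 x :=
  ⟨posPart_nonneg _, posPart_sub_le_of_le hx (le_add_of_nonneg_left hy)⟩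

theorem sum_posPart_sub_sum_lt_le {ι : Type*} [LinearOrder ι] {x : ι → E} {p : E} (hp : 0 ≤ p)
    (s : Finset ι) (hx : ∀ i ∈ s, x i ∈ Icc 0 p) :
    ∑ i ∈ s, (x i - ∑ j ∈ s with i < j, x j)⁺ ≤ p := by
  induction s using Finset.induction_on_min with
  | empty => simpa using hp
  | insert a s ha ih =>
    rw [Finset.forall_mem_insert] at hx
    have has : a ∉ s := fun h => (ha a h).false
    set σ := ∑ i ∈ s, (x i - ∑ j ∈ s with i < j, x j)⁺
    have h_head : {j ∈ insert a s | a < j} = s := by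
      rw [Finset.filter_insert, if_neg (lt_irrefl a), Finset.filter_true_of_mem ha]
    have h_tail : ∑ i ∈ s, (x i - ∑ j ∈ insert a s with i < j, x j)⁺ = σ :=
      Finset.sum_congr rfl fun i hi => by rw [Finset.filter_insert, if_neg (ha i hi).le.not_gt]
    have hσ_le : σ ≤ ∑ i ∈ s, x i :=
      Finset.sum_le_sum fun i hi => (posPart_sub_mem_Icc (hx.2 i hi).1 <|
        Finset.sum_nonneg fun j hj => (hx.2 j (Finset.mem_filter.1 hj).1).1).2
    rw [Finset.sum_insert has, h_head, h_tail, ← le_sub_iff_add_le]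
    refine posPart_sub_le_of_le (sub_nonneg.2 (ih hx.2)) ?_
    calc x a ≤ p := hx.1.2
      _ = σ + (p - σ) := (add_sub_cancel σ p).symm
      _ ≤ ∑ i ∈ s, x i + (p - σ) := add_le_add_left hσ_le _

theorem exists_abs_le_and_abs_sub_le_posPart (x : E) {c : E} (hc : 0 ≤ c) :
    ∃ y, |y| ≤ c ∧ |y| ≤ |x| ∧ |x - y| ≤ (|x| - c)⁺ := by
  have h_neg : -c ≤ 0 := neg_nonpos.2 hc
  refine ⟨x ⊓ c ⊔ -c, ?_, ?_, ?_⟩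
  · exact abs_le'.2 ⟨sup_le inf_le_right (h_neg.trans hc), neg_le.2 le_sup_right⟩
  · refine abs_le'.2 ⟨sup_le (inf_le_left.trans (le_abs_self x)) (h_neg.trans (abs_nonneg x)), ?_⟩
    exact neg_le.2 (le_sup_of_le_left (le_inf (neg_le.1 (neg_le_abs x))
      ((neg_nonpos.2 (abs_nonneg x)).trans hc)))
  · refine abs_le'.2 ⟨?_, ?_⟩
    · calc x - (x ⊓ c ⊔ -c) ≤ x - x ⊓ c := sub_le_sub_left le_sup_left _
        _ = (x - c)⁺ := by rw [inf_eq_sub_posPart_sub, sub_sub_cancel]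
        _ ≤ (|x| - c)⁺ := posPart_mono (sub_le_sub_right (le_abs_self x) c)
    · rw [neg_sub, sup_sub]
      refine sup_le ((sub_nonpos.2 inf_le_left).trans (posPart_nonneg _)) ?_
      rw [neg_sub_left, add_comm, neg_add_rev, ← sub_eq_add_neg]
      exact (sub_le_sub_right (neg_le_abs x) c).trans (le_posPart _)

end VectorLattice

section OrderBoundedSeries

variable {E : Type*} [AddCommGroup E] [PartialOrder E] {ι κ : Type*} {w : ι → E} {v : E}

/-- The family `w` consists of positive elements and all its finite sums are at most `v`. Such
families play the role of the disjoint sequences in `[0, v]`, which are a special case. -/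
structure OrderBoundedSeries (w : ι → E) (v : E) : Prop where
  nonneg (i : ι) : 0 ≤ w i
  sum_le (s : Finset ι) : ∑ i ∈ s, w i ≤ v

namespace OrderBoundedSeries

theorem mem_Icc (hw : OrderBoundedSeries w v) (i : ι) : w i ∈ Icc 0 v :=
  ⟨hw.nonneg i, by simpa using hw.sum_le {i}⟩

theorem zero_le (hw : OrderBoundedSeries w v) : 0 ≤ v := by
  simpa using hw.sum_le ∅

theorem comp_injective (hw : OrderBoundedSeries w v) {φ : κ → ι} (hφ : φ.Injective) :
    OrderBoundedSeries (fun k => w (φ k)) v where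
  nonneg k := hw.nonneg (φ k)
  sum_le s := by simpa using hw.sum_le (s.map ⟨φ, hφ⟩)

variable [IsOrderedAddMonoid E]

theorem sum_mem_Icc (hw : OrderBoundedSeries w v) (s : Finset ι) : ∑ i ∈ s, w i ∈ Icc 0 v :=
  ⟨Finset.sum_nonneg fun i _ => hw.nonneg i, hw.sum_le s⟩

theorem monotone_sum_range {w : ℕ → E} (hw : OrderBoundedSeries w v) :
    Monotone fun n => ∑ k ∈ Finset.range n, w k := fun _ _ hmn =>
  Finset.sum_le_sum_of_subset_of_nonneg (Finset.range_mono hmn) fun k _ _ => hw.nonneg k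

theorem of_sum_range_le {w : ℕ → E} (hw : ∀ n, 0 ≤ w n)
    (hsum : ∀ n, ∑ k ∈ Finset.range n, w k ≤ v) : OrderBoundedSeries w v where
  nonneg := hw
  sum_le s := by
    obtain ⟨n, hn⟩ := s.exists_nat_subset_range
    exact (Finset.sum_le_sum_of_subset_of_nonneg hn fun i _ _ => hw i).trans (hsum n)

theorem exists_of_forall_exists_remainder {P Q : E → Prop}
    (h : ∀ p, P p → ∃ w ∈ Icc 0 p, Q w ∧ P (p - w)) (hv : P v) :
    ∃ w : ℕ → E, OrderBoundedSeries w v ∧ ∀ n, Q (w n) := by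
  choose! Z hZ hQ hP using h
  let r : ℕ → E := fun n => (fun p => p - Z p)^[n] v
  have hr_succ (n : ℕ) : r (n + 1) = r n - Z (r n) := Function.iterate_succ_apply' _ n v
  have hPr (n : ℕ) : P (r n) := by
    induction n with
    | zero => exact hv
    | succ n ih => exact hr_succ n ▸ hP _ ih
  have h_sum (n : ℕ) : ∑ k ∈ Finset.range n, Z (r k) = v - r n := by
    rw [show v = r 0 from rfl, ← Finset.sum_range_sub' r n]
    exact Finset.sum_congr rfl fun k _ => by rw [hr_succ, sub_sub_cancel]
  refine ⟨fun n => Z (r n), of_sum_range_le (fun n => (hZ _ (hPr n)).1) fun n => ?_,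
    fun n => hQ _ (hPr n)⟩
  rw [h_sum]
  exact sub_le_self v ((hZ _ (hPr n)).1.trans (hZ _ (hPr n)).2)

end OrderBoundedSeries

end OrderBoundedSeries

section NormedLattice

variable {E : Type*} [NormedAddCommGroup E] [Lattice E]

theorem norm_posPart_abs_smul_sub_smul [NormedSpace ℝ E] [IsOrderedModule ℝ E] {c : ℝ}
    (hc : 0 < c) (x p : E) :
    ‖(|c • x| - c • p)⁺‖ = c * ‖(|x| - p)⁺‖ := by
  have h_posPart : (c • (|x| - p))⁺ = c • (|x| - p)⁺ := by
    rw [posPart_def, posPart_def, smul_sup_of_pos hc, smul_zero]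
  rw [abs_smul_of_pos hc, ← smul_sub, h_posPart, norm_smul, Real.norm_of_nonneg hc.le]

variable [IsOrderedAddMonoid E] [HasSolidNorm E]

theorem norm_le_norm_of_mem_Icc {x p : E} (hx : x ∈ Icc 0 p) : ‖x‖ ≤ ‖p‖ :=
  norm_le_norm_of_abs_le_abs (abs_le_abs_of_nonneg hx.1 hx.2)

theorem norm_posPart_abs_add_sub_add_le (x y p q : E) :
    ‖(|x + y| - (p + q))⁺‖ ≤ ‖(|x| - p)⁺‖ + ‖(|y| - q)⁺‖ := by
  refine (norm_le_norm_of_mem_Icc ⟨posPart_nonneg _, ?_⟩).trans (norm_add_le _ _)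
  refine sup_le ?_ (add_nonneg (posPart_nonneg _) (posPart_nonneg _))
  calc |x + y| - (p + q) ≤ |x| + |y| - (p + q) := sub_le_sub_right (abs_add_le x y) _
    _ = (|x| - p) + (|y| - q) := add_sub_add_comm _ _ _ _
    _ ≤ (|x| - p)⁺ + (|y| - q)⁺ := add_le_add (le_posPart _) (le_posPart _)

variable [NormedSpace ℝ E] [IsOrderedModule ℝ E]

/-- Hahn–Banach on `E × E`: extending `(0, x) ↦ f x` below `(p, x) ↦ ‖f‖ * ‖(|x| - p)⁺‖` encodes
domination of `f`, positivity and the norm bound in a single sublinear functional. -/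
theorem exists_linearMap_prod_le_norm_posPart (f : StrongDual ℝ E) :
    ∃ Φ : E × E →ₗ[ℝ] ℝ, (∀ x, Φ (0, x) = f x) ∧
      ∀ p x, Φ (p, x) ≤ ‖f‖ * ‖(|x| - p)⁺‖ := by
  let F : (E × E) →ₗ.[ℝ] ℝ :=
    { domain := Submodule.prod ⊥ ⊤
      toFun := (f : E →ₗ[ℝ] ℝ) ∘ₗ LinearMap.snd ℝ E E ∘ₗ Submodule.subtype _ }
  have hF (z : F.domain) : F z ≤ ‖f‖ * ‖(|z.1.2| - z.1.1)⁺‖ := by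
    have h_fst : z.1.1 = 0 := by simpa using (Submodule.mem_prod.1 z.2).1
    rw [h_fst, sub_zero, posPart_eq_self.2 (abs_nonneg _), norm_abs_eq_norm]
    exact (le_abs_self _).trans (f.le_opNorm z.1.2)
  obtain ⟨Φ, hΦF, hΦ⟩ := exists_extension_of_le_sublinear F
    (fun z => ‖f‖ * ‖(|z.2| - z.1)⁺‖)
    (fun c hc z => by
      rw [Prod.smul_snd, Prod.smul_fst, norm_posPart_abs_smul_sub_smul hc, mul_left_comm])
    (fun z z' => by
      rw [← mul_add]
      exact mul_le_mul_of_nonneg_left (norm_posPart_abs_add_sub_add_le _ _ _ _) (norm_nonneg f))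
    hF
  exact ⟨Φ, fun x => hΦF ⟨(0, x), Submodule.mem_prod.2 ⟨by simp, trivial⟩⟩,
    fun p x => hΦ (p, x)⟩

theorem exists_monotone_abs_apply_le (f : StrongDual ℝ E) :
    ∃ g : StrongDual ℝ E, Monotone g ∧ (∀ x, |f x| ≤ g |x|) ∧ ‖g‖ ≤ ‖f‖ := by
  obtain ⟨Φ, hΦf, hΦ⟩ := exists_linearMap_prod_le_norm_posPart f
  let G : E →ₗ[ℝ] ℝ := -(Φ ∘ₗ LinearMap.inl ℝ E E)
  have hG (p : E) : G p = -Φ (p, 0) := rfl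
  have hG_neg (p : E) : G p = Φ (-p, 0) := by rw [hG, ← map_neg, Prod.neg_mk, neg_zero]
  have hG_le (p : E) : G p ≤ ‖f‖ * ‖p‖ := by
    rw [hG_neg]
    refine (hΦ (-p) 0).trans (mul_le_mul_of_nonneg_left ?_ (norm_nonneg f))
    rw [abs_zero, zero_sub, neg_neg, ← norm_abs_eq_norm p]
    exact norm_le_norm_of_mem_Icc ⟨posPart_nonneg p, sup_le (le_abs_self p) (abs_nonneg p)⟩
  have hG_abs (p : E) : ‖G p‖ ≤ ‖f‖ * ‖p‖ :=
    abs_le'.2 ⟨hG_le p, by simpa only [map_neg, norm_neg] using hG_le (-p)⟩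
  have hG_nonneg (p : E) (hp : 0 ≤ p) : 0 ≤ G p := by
    have h := hΦ p 0
    rw [abs_zero, zero_sub, posPart_eq_zero.2 (neg_nonpos.2 hp), norm_zero, mul_zero] at h
    exact neg_nonneg.2 h
  have h_le (x : E) : f x ≤ G |x| := by
    have h := hΦ |x| x
    rw [sub_self, posPart_zero, norm_zero, mul_zero, ← Prod.fst_add_snd (|x|, x), map_add,
      hΦf] at h
    rw [hG]
    linarith
  exact ⟨G.mkContinuous ‖f‖ hG_abs, (monotone_iff_map_nonneg G).2 hG_nonneg,
    fun x => abs_le'.2 ⟨h_le x, by simpa only [map_neg, abs_neg] using! h_le (-x)⟩,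
    G.mkContinuous_norm_le (norm_nonneg f) hG_abs⟩

variable {Y : Type*} [NormedAddCommGroup Y] [NormedSpace ℝ Y]

theorem exists_dual_apply_eq_norm_and_monotone_le (T : E →L[ℝ] Y) (x : E) :
    ∃ (f : StrongDual ℝ Y) (h : StrongDual ℝ E), ‖f‖ ≤ 1 ∧ f (T x) = ‖T x‖ ∧ Monotone h ∧
      ‖h‖ ≤ ‖T‖ ∧ ∀ y, |f (T y)| ≤ h |y| := by
  obtain ⟨f, hf, hfx⟩ := exists_dual_vector'' ℝ (T x)
  obtain ⟨h, h_mono, hfh, h_norm⟩ := exists_monotone_abs_apply_le (f ∘L T)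
  refine ⟨f, h, hf, hfx, h_mono, ?_, hfh⟩
  calc ‖h‖ ≤ ‖f‖ * ‖T‖ := h_norm.trans (f.opNorm_comp_le T)
    _ ≤ 1 * ‖T‖ := mul_le_mul_of_nonneg_right hf (norm_nonneg T)
    _ = ‖T‖ := one_mul _

theorem exists_monotone_norm_apply_le_add (T : E →L[ℝ] Y) (x : E) :
    ∃ h : StrongDual ℝ E, Monotone h ∧ ‖h‖ ≤ ‖T‖ ∧ ∀ y, ‖T x‖ ≤ h |y| + ‖T (x - y)‖ := by
  obtain ⟨f, h, hf, hfx, h_mono, h_norm, hfh⟩ := exists_dual_apply_eq_norm_and_monotone_le T x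
  refine ⟨h, h_mono, h_norm, fun y => ?_⟩
  calc ‖T x‖ = f (T y) + f (T (x - y)) := by rw [← map_add, ← map_add, add_sub_cancel, hfx]
    _ ≤ h |y| + ‖T (x - y)‖ := add_le_add ((le_abs_self _).trans (hfh y))
        ((le_abs_self _).trans (f.le_of_opNorm_le hf _ |>.trans_eq (one_mul _)))

end NormedLattice

section Rosenthal

theorem exists_injective_forall_sum_le {η : ℝ} (hη : 0 ≤ η) (m : ℕ) (a : ℕ → ℕ → ℝ)
    (ha : ∀ n k, 0 ≤ a n k) (hsum : ∀ n, ∀ F : Finset ℕ, ∑ k ∈ F, a n k ≤ m * η) :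
    ∃ φ : ℕ → ℕ, φ.Injective ∧ ∀ n, ∀ F : Finset ℕ, n ∉ F → ∑ k ∈ F, a (φ n) (φ k) ≤ η := by
  induction m generalizing a with
  | zero =>
    exact ⟨id, Function.injective_id, fun n F _ => (hsum n F).trans (by simpa using hη)⟩
  | succ m ih =>
    -- Split `ℕ` into infinitely many infinite rows. If no row works, each row `p` has an `n p`
    -- whose sum over a part of its own row exceeds `η`; so the bound drops by `η` along
    -- `p ↦ (p, n p)`.
    by_cases h_row : ∃ p, ∀ n, ∀ F : Finset ℕ, n ∉ F →
        ∑ k ∈ F, a (Nat.pair p n) (Nat.pair p k) ≤ η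
    · obtain ⟨p, hp⟩ := h_row
      exact ⟨Nat.pair p, fun i j hij => (Nat.pair_eq_pair.1 hij).2, hp⟩
    push Not at h_row
    choose n F hnF hF using h_row
    have h_inj : Function.Injective fun p => Nat.pair p (n p) :=
      fun i j hij => (Nat.pair_eq_pair.1 hij).1
    have h_bound (p : ℕ) (G : Finset ℕ) :
        ∑ q ∈ G, a (Nat.pair p (n p)) (Nat.pair q (n q)) ≤ m * η := by
      have h_disj : Disjoint (G.image fun q => Nat.pair q (n q)) ((F p).image (Nat.pair p)) := by
        simp only [Finset.disjoint_left, Finset.mem_image]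
        rintro _ ⟨q, -, rfl⟩ ⟨k, hk, hkq⟩
        obtain ⟨rfl, rfl⟩ := Nat.pair_eq_pair.1 hkq
        exact hnF _ hk
      have h_union := hsum (Nat.pair p (n p))
        ((G.image fun q => Nat.pair q (n q)) ∪ (F p).image (Nat.pair p))
      rw [Finset.sum_union h_disj, Finset.sum_image h_inj.injOn,
        Finset.sum_image fun i _ j _ hij => (Nat.pair_eq_pair.1 hij).2] at h_union
      have h_own_row := hF p
      push_cast at h_union
      linarith
    obtain ⟨φ, hφ, hφ_sum⟩ := ih (fun p q => a (Nat.pair p (n p)) (Nat.pair q (n q)))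
      (fun p q => ha _ _) h_bound
    exact ⟨fun i => Nat.pair (φ i) (n (φ i)), h_inj.comp hφ, hφ_sum⟩

end Rosenthal

section OrderWeaklyCompact

theorem mem_closure_of_mapClusterPt_toWeakSpace {Y : Type*} [NormedAddCommGroup Y]
    [NormedSpace ℝ Y] {ι : Type*} {l : Filter ι} {s : ι → Y} {y : Y} {C : Set Y}
    (hy : MapClusterPt (toWeakSpace ℝ Y y) l fun i => toWeakSpace ℝ Y (s i))
    (hC : Convex ℝ C) (hs : ∀ᶠ i in l, s i ∈ C) : y ∈ closure C := by
  have h_weak : toWeakSpace ℝ Y y ∈ closure (toWeakSpace ℝ Y '' C) :=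
    ClusterPt.mem_closure (hy.clusterPt.mono (le_principal_iff.2 <|
      hs.mono fun i hi => mem_image_of_mem _ hi))
  rw [← hC.toWeakSpace_closure ℝ] at h_weak
  exact (toWeakSpace ℝ Y).injective.mem_set_image.1 h_weak

theorem le_apply_of_mapClusterPt_toWeakSpace {Y : Type*} [NormedAddCommGroup Y]
    [NormedSpace ℝ Y] {ι : Type*} {l : Filter ι} {s : ι → Y} {y : Y}
    (hy : MapClusterPt (toWeakSpace ℝ Y y) l fun i => toWeakSpace ℝ Y (s i))
    {f : StrongDual ℝ Y} {c : ℝ} (hs : ∀ᶠ i in l, c ≤ f (s i)) : c ≤ f y :=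
  (isClosed_Ici.preimage f.continuous).closure_subset <|
    mem_closure_of_mapClusterPt_toWeakSpace hy
      ((convex_Ici c).linear_preimage (f : Y →ₗ[ℝ] ℝ)) hs

variable {E : Type*} [NormedAddCommGroup E] [NormedSpace ℝ E] [Lattice E] [IsOrderedAddMonoid E]
  [IsOrderedModule ℝ E] {Y : Type*} [NormedAddCommGroup Y] [NormedSpace ℝ Y]

theorem exists_mem_Icc_norm_sub_lt_of_mapClusterPt (T : E →L[ℝ] Y) {σ : ℕ → E} (hσ : Monotone σ)
    (hσ_nonneg : ∀ n, 0 ≤ σ n) {y : Y}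
    (hy : MapClusterPt (toWeakSpace ℝ Y y) atTop fun n => toWeakSpace ℝ Y (T (σ n)))
    {η : ℝ} (hη : 0 < η) : ∃ n, ∃ a ∈ Icc 0 (σ n), ‖y - T a‖ < η := by
  have h_conv : Convex ℝ (⋃ n, T '' Icc 0 (σ n)) := by
    refine Directed.convex_iUnion (Monotone.directed_le fun m n hmn => ?_)
      fun n => (convex_Icc 0 (σ n)).linear_image (T : E →ₗ[ℝ] Y)
    exact image_mono (Icc_subset_Icc_right (hσ hmn))
  have h_closure := mem_closure_of_mapClusterPt_toWeakSpace hy h_conv <| .of_forall fun n =>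
    mem_iUnion.2 ⟨n, mem_image_of_mem T (right_mem_Icc.2 (hσ_nonneg n))⟩
  obtain ⟨_, hb, hyb⟩ := Metric.mem_closure_iff.1 h_closure η hη
  obtain ⟨n, a, ha, rfl⟩ := mem_iUnion.1 hb
  exact ⟨n, a, ha, by rwa [← dist_eq_norm]⟩

variable [HasSolidNorm E]

theorem OrderBoundedSeries.exists_injective_almost_biorthogonal {w : ℕ → E} {v : E}
    (hw : OrderBoundedSeries w v) (T : E →L[ℝ] Y) {η : ℝ} (hη : 0 < η) :
    ∃ (φ : ℕ → ℕ) (f : ℕ → StrongDual ℝ Y), φ.Injective ∧ (∀ n, ‖f n‖ ≤ 1) ∧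
      (∀ n, f n (T (w (φ n))) = ‖T (w (φ n))‖) ∧
      ∀ n, ∀ F : Finset ℕ, n ∉ F → ∀ a ∈ Icc 0 (∑ k ∈ F, w (φ k)), |f n (T a)| ≤ η := by
  choose f h hf hfw h_mono h_norm hfh using
    fun n => exists_dual_apply_eq_norm_and_monotone_le T (w n)
  obtain ⟨m, hm⟩ := exists_nat_ge (‖T‖ * ‖v‖ / η)
  have h_sum (n : ℕ) (F : Finset ℕ) : ∑ k ∈ F, h n (w k) ≤ m * η :=
    calc ∑ k ∈ F, h n (w k) = h n (∑ k ∈ F, w k) := (map_sum _ _ _).symm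
      _ ≤ h n v := h_mono n (hw.sum_le F)
      _ ≤ ‖T‖ * ‖v‖ := (le_abs_self _).trans ((h n).le_of_opNorm_le (h_norm n) v)
      _ ≤ m * η := (div_le_iff₀ hη).1 hm
  obtain ⟨φ, hφ, hφ_sum⟩ := exists_injective_forall_sum_le hη.le m (fun n k => h n (w k))
    (fun n k => (monotone_iff_map_nonneg (h n)).1 (h_mono n) _ (hw.nonneg k)) h_sum
  refine ⟨φ, f ∘ φ, hφ, fun n => hf _, fun n => hfw _, fun n F hF a ha => ?_⟩
  calc |f (φ n) (T a)| ≤ h (φ n) |a| := hfh _ a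
    _ = h (φ n) a := by rw [abs_of_nonneg ha.1]
    _ ≤ h (φ n) (∑ k ∈ F, w (φ k)) := h_mono _ ha.2
    _ = ∑ k ∈ F, h (φ n) (w (φ k)) := map_sum _ _ _
    _ ≤ η := hφ_sum n F hF

theorem OrderWeaklyCompact.not_forall_le_norm_apply {T : E →L[ℝ] Y} (hT : OrderWeaklyCompact T)
    {w : ℕ → E} {v : E} (hw : OrderBoundedSeries w v) {ε : ℝ} (hε : 0 < ε) :
    ¬ ∀ n, ε ≤ ‖T (w n)‖ := by
  intro hTw
  obtain ⟨φ, f, hφ, hf, hfw, hf_le⟩ :=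
    hw.exists_injective_almost_biorthogonal T (by positivity : 0 < ε / 4)
  have he := hw.comp_injective hφ
  let σ : ℕ → E := fun n => ∑ k ∈ Finset.range n, w (φ k)
  obtain ⟨z, -, hz⟩ := (hT v he.zero_le).exists_mapClusterPt_of_frequently (l := atTop)
    (f := fun n => toWeakSpace ℝ Y (T (σ n))) <| Frequently.of_forall fun n =>
      subset_closure (mem_image_of_mem _ (mem_image_of_mem T (he.sum_mem_Icc _)))
  obtain ⟨y, rfl⟩ := (toWeakSpace ℝ Y).surjective z
  -- The functional `f n` separates `y` from `T '' Icc 0 (σ n)` by `ε / 2`.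
  have h_lower (n : ℕ) : ε - ε / 4 ≤ f n y := by
    refine le_apply_of_mapClusterPt_toWeakSpace hz ?_
    filter_upwards [eventually_gt_atTop n] with k hk
    have hσk : σ k = w (φ n) + ∑ i ∈ (Finset.range k).erase n, w (φ i) :=
      (Finset.add_sum_erase _ _ (Finset.mem_range.2 hk)).symm
    have h_rest := abs_le.1 <| hf_le n _ (Finset.notMem_erase n (Finset.range k)) _
      (right_mem_Icc.2 (he.sum_mem_Icc _).1)
    rw [hσk, map_add, map_add, hfw]
    linarith [hTw (φ n), h_rest.1]
  obtain ⟨n, a, ha, hya⟩ := exists_mem_Icc_norm_sub_lt_of_mapClusterPt T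
    he.monotone_sum_range (fun n => (he.sum_mem_Icc _).1) hz (by positivity : 0 < ε / 4)
  have h_upper : f n y ≤ ε / 4 + ε / 4 :=
    calc f n y = f n (T a) + f n (y - T a) := by rw [← map_add, add_sub_cancel]
      _ ≤ ε / 4 + ‖y - T a‖ := add_le_add
          ((le_abs_self _).trans (hf_le n _ Finset.notMem_range_self a ha))
          ((le_abs_self _).trans (((f n).le_of_opNorm_le (hf n) _).trans_eq (one_mul _)))
      _ ≤ ε / 4 + ε / 4 := by gcongr
  linarith [h_lower n]

theorem OrderWeaklyCompact.tendsto_apply_of_orderBoundedSeries {T : E →L[ℝ] Y}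
    (hT : OrderWeaklyCompact T) {w : ℕ → E} {v : E} (hw : OrderBoundedSeries w v) :
    Tendsto (fun n => T (w n)) atTop (𝓝 0) := by
  rw [Metric.tendsto_nhds]
  by_contra! h_not
  obtain ⟨ε, hε, h_freq⟩ := h_not
  obtain ⟨φ, hφ, hφw⟩ := extraction_of_frequently_atTop h_freq
  exact hT.not_forall_le_norm_apply (hw.comp_injective hφ.injective) hε fun n => by
    simpa using hφw n

end OrderWeaklyCompact

section AlmostDominated

variable {E : Type*} [NormedAddCommGroup E] [NormedSpace ℝ E] [Lattice E]
  {Y : Type*} [NormedAddCommGroup Y] [NormedSpace ℝ Y]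

/-- On `[0, p]`, the operator `T` is dominated in norm by a positive functional, up to `ε`. -/
def AlmostDominatedOn (T : E →L[ℝ] Y) (p : E) (ε : ℝ) : Prop :=
  ∃ g : StrongDual ℝ E, Monotone g ∧ ∀ x ∈ Icc 0 p, ‖T x‖ ≤ g x + ε

/-- On every order interval, `T` is dominated in norm by positive functionals up to an arbitrarily
small error. This is condition (4) of the theorem, which can do without the truncation `|x| ⊓ u`
since `|x| ≤ v`. -/
def AlmostDominated (T : E →L[ℝ] Y) : Prop :=
  ∀ ε : ℝ, 0 < ε → ∀ v : E, 0 ≤ v → AlmostDominatedOn T v ε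

theorem monotone_sum_apply [IsOrderedAddMonoid E] {ι : Type*} {s : Finset ι}
    {g : ι → StrongDual ℝ E} (hg : ∀ i ∈ s, Monotone (g i)) :
    Monotone ⇑(∑ i ∈ s, g i) := by
  intro x y hxy
  simpa only [sum_apply] using Finset.sum_le_sum fun i hi => hg i hi hxy

theorem single_apply_le_sum_apply {ι : Type*} {s : Finset ι} {g : ι → StrongDual ℝ E}
    (hg : ∀ i ∈ s, Monotone (g i)) {i : ι} (hi : i ∈ s) {x : E} (hx : 0 ≤ x) :
    g i x ≤ (∑ i ∈ s, g i) x := by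
  rw [sum_apply]
  exact Finset.single_le_sum (f := fun i => g i x)
    (fun j hj => (map_zero (g j)).ge.trans (hg j hj hx)) hi

variable [IsOrderedAddMonoid E] [HasSolidNorm E]

theorem norm_apply_le_of_mem_Icc {F : Type*} [SeminormedAddCommGroup F] [NormedSpace ℝ F]
    (T : E →L[ℝ] F) {x p : E} (hx : x ∈ Icc 0 p) : ‖T x‖ ≤ ‖T‖ * ‖p‖ :=
  (T.le_opNorm x).trans (mul_le_mul_of_nonneg_left (norm_le_norm_of_mem_Icc hx) (norm_nonneg T))

variable [IsOrderedModule ℝ E] {T : E →L[ℝ] Y} {p v : E} {ε ε' : ℝ}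

theorem exists_seq_of_not_almostDominatedOn (hT : ¬ AlmostDominatedOn T p ε) {δ : ℝ}
    (hδ : 0 < δ) :
    ∃ (x : ℕ → E) (h : ℕ → StrongDual ℝ E), (∀ n, x n ∈ Icc 0 p) ∧ (∀ n, Monotone (h n)) ∧
      (∀ n y, ε < h n |y| + ‖T (x n - y)‖) ∧ ∀ m n, m < n → h m (x n) ≤ δ := by
  set M := ‖T‖ * ‖p‖ + |ε|
  have hM : 0 ≤ M := by positivity
  obtain ⟨xh, hxh, h_lt⟩ := exists_seq_of_forall_finset_exists
    (fun q : E × StrongDual ℝ E => q.1 ∈ Icc 0 p ∧ Monotone q.2 ∧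
      ∀ y, ε < q.2 |y| + ‖T (q.1 - y)‖)
    (fun q q' => q.2 q'.1 ≤ δ) fun s hs => by
      set g : StrongDual ℝ E := ∑ q ∈ s, q.2
      have hg : Monotone g := monotone_sum_apply fun q hq => (hs q hq).2.1
      obtain ⟨x, hx, hgx⟩ : ∃ x ∈ Icc 0 p, ((M / δ) • g) x + ε < ‖T x‖ := by
        by_contra! h_dom
        exact hT ⟨_, hg.const_mul (div_nonneg hM hδ.le), h_dom⟩
      have hgx₀ : 0 ≤ g x := (map_zero g).ge.trans (hg hx.1)
      have hTx : ε < ‖T x‖ := lt_of_le_of_lt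
        (le_add_of_nonneg_left (mul_nonneg (div_nonneg hM hδ.le) hgx₀)) hgx
      have hgxδ : g x ≤ δ := by
        by_contra! h_gt
        have hMg : M ≤ M / δ * g x :=
          (div_mul_cancel₀ M hδ.ne').ge.trans (by gcongr)
        have hTM := norm_apply_le_of_mem_Icc T hx
        rw [smul_apply, smul_eq_mul] at hgx
        linarith [neg_abs_le ε]
      obtain ⟨h, h_mono, -, hTh⟩ := exists_monotone_norm_apply_le_add T x
      refine ⟨(x, h), ⟨hx, h_mono, fun y => hTx.trans_le (hTh y)⟩, fun q hq => ?_⟩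
      exact (single_apply_le_sum_apply (fun q hq => (hs q hq).2.1) hq hx.1).trans hgxδ
  exact ⟨fun n => (xh n).1, fun n => (xh n).2, fun n => (hxh n).1, fun n => (hxh n).2.1,
    fun n => (hxh n).2.2, fun m n hmn => h_lt m n hmn⟩

theorem exists_fin_of_not_almostDominatedOn (hp : 0 ≤ p) (hT : ¬ AlmostDominatedOn T p ε)
    (hε' : ε' < ε) (N : ℕ) :
    ∃ w : Fin N → E, (∀ i, 0 ≤ w i) ∧ ∑ i, w i ≤ p ∧ ∀ i, ε' ≤ ‖T (w i)‖ := by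
  have hδ : 0 < (ε - ε') / (N + 1) := div_pos (sub_pos.2 hε') N.cast_add_one_pos
  obtain ⟨x, h, hx, h_mono, hxh, h_lt⟩ := exists_seq_of_not_almostDominatedOn hT hδ
  let t (i : Fin N) : E := ∑ j with i < j, x j
  refine ⟨fun i => (x i - t i)⁺, fun i => posPart_nonneg _,
    sum_posPart_sub_sum_lt_le hp Finset.univ fun i _ => hx i, fun i => ?_⟩
  have ht : 0 ≤ t i := Finset.sum_nonneg fun j _ => (hx j).1
  have h_small : h i (x i ⊓ t i) ≤ ε - ε' :=
    calc h i (x i ⊓ t i) ≤ h i (t i) := h_mono i inf_le_right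
      _ = ∑ j with i < j, h i (x j) := map_sum _ _ _
      _ ≤ Finset.card {j | i < j} • ((ε - ε') / (N + 1)) :=
        Finset.sum_le_card_nsmul _ _ _ fun j hj => h_lt i j (Finset.mem_filter.1 hj).2
      _ ≤ (N + 1) * ((ε - ε') / (N + 1)) := by
        rw [nsmul_eq_mul]
        gcongr
        exact_mod_cast (Finset.card_le_univ _).trans (by simp)
      _ = ε - ε' := mul_div_cancel₀ _ N.cast_add_one_ne_zero
  have h_split := hxh i (x i ⊓ t i)
  rw [abs_of_nonneg (le_inf (hx i).1 ht), inf_eq_sub_posPart_sub, sub_sub_cancel,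
    ← inf_eq_sub_posPart_sub] at h_split
  linarith

theorem exists_remainder_of_not_almostDominatedOn (hp : 0 ≤ p) (hT : ¬ AlmostDominatedOn T p ε)
    (hε' : ε' < ε) : ∃ w ∈ Icc 0 p, ε' ≤ ‖T w‖ ∧ ¬ AlmostDominatedOn T (p - w) ε' := by
  obtain ⟨N, hN⟩ := exists_nat_gt (‖T‖ * ‖p‖ / (ε - ε'))
  obtain ⟨w, hw, hwp, hTw⟩ := exists_fin_of_not_almostDominatedOn hp hT hε' N
  have hw_mem (i : Fin N) : w i ∈ Icc 0 p :=
    ⟨hw i, (Finset.single_le_sum (fun j _ => hw j) (Finset.mem_univ i)).trans hwp⟩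
  by_contra! h_dom
  choose g hg hTg using fun i => h_dom (w i) (hw_mem i) (hTw i)
  obtain ⟨x, hx, hgx⟩ : ∃ x ∈ Icc 0 p, (∑ i, g i) x + ε < ‖T x‖ := by
    by_contra! h_dom
    exact hT ⟨_, monotone_sum_apply fun i _ => hg i, h_dom⟩
  -- Each `g i` dominates `T` on `[0, p - w i]`, but their sum does not at `x`. So the functional
  -- norming `T x` is large at every one of the `N` elements `w i`, and their sum is at most `p`.
  obtain ⟨h, h_mono, h_norm, hTh⟩ := exists_monotone_norm_apply_le_add T x
  have h_large (i : Fin N) : ε - ε' ≤ h (w i) := by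
    have h_mem : (x - w i)⁺ ∈ Icc 0 (p - w i) :=
      ⟨posPart_nonneg _, posPart_sub_le_of_le (sub_nonneg.2 (hw_mem i).2) (by simpa using hx.2)⟩
    have h_gi : g i (x - w i)⁺ ≤ (∑ j, g j) x :=
      (hg i (posPart_sub_mem_Icc hx.1 (hw i)).2).trans
        (single_apply_le_sum_apply (fun j _ => hg j) (Finset.mem_univ i) hx.1)
    have h_split := hTh (x ⊓ w i)
    rw [abs_of_nonneg (le_inf hx.1 (hw i))] at h_split
    have h_inf : x - x ⊓ w i = (x - w i)⁺ := by rw [inf_eq_sub_posPart_sub, sub_sub_cancel]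
    rw [h_inf] at h_split
    linarith [hTg i _ h_mem, h_mono (inf_le_right : x ⊓ w i ≤ w i)]
  have h_le : N * (ε - ε') ≤ ‖T‖ * ‖p‖ :=
    calc N * (ε - ε') = ∑ _i : Fin N, (ε - ε') := by simp [mul_sub]
      _ ≤ ∑ i, h (w i) := Finset.sum_le_sum fun i _ => h_large i
      _ = h (∑ i, w i) := (map_sum _ _ _).symm
      _ ≤ h p := h_mono hwp
      _ ≤ ‖T‖ * ‖p‖ := (le_abs_self _).trans (h.le_of_opNorm_le h_norm p)
  exact h_le.not_gt ((div_lt_iff₀ (sub_pos.2 hε')).1 hN)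

theorem exists_orderBoundedSeries_of_not_almostDominatedOn (hv : 0 ≤ v)
    (hT : ¬ AlmostDominatedOn T v ε) (hε' : ε' < ε) :
    ∃ w : ℕ → E, OrderBoundedSeries w v ∧ ∀ n, ε' ≤ ‖T (w n)‖ := by
  refine OrderBoundedSeries.exists_of_forall_exists_remainder
    (P := fun p => 0 ≤ p ∧ ∃ ε > ε', ¬ AlmostDominatedOn T p ε) (Q := fun w => ε' ≤ ‖T w‖) ?_
    ⟨hv, ε, hε', hT⟩
  rintro p ⟨hp, ε₁, hε₁, hTp⟩
  obtain ⟨ε₂, hε₂, hε₂₁⟩ := exists_between hε₁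
  obtain ⟨w, hw, hTw, hTpw⟩ := exists_remainder_of_not_almostDominatedOn hp hTp hε₂₁
  exact ⟨w, hw, hε₂.le.trans hTw, sub_nonneg.2 hw.2, ε₂, hε₂, hTpw⟩

theorem almostDominated_of_tendsto_of_orderBoundedSeries
    (hT : ∀ v : E, ∀ w : ℕ → E, OrderBoundedSeries w v → Tendsto (fun n => T (w n)) atTop (𝓝 0)) :
    AlmostDominated T := by
  intro ε hε v hv
  by_contra h_not
  obtain ⟨w, hw, hTw⟩ :=
    exists_orderBoundedSeries_of_not_almostDominatedOn hv h_not (half_lt_self hε)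
  have h_lim : ε / 2 ≤ ‖(0 : Y)‖ := ge_of_tendsto' (hT v w hw).norm hTw
  rw [norm_zero] at h_lim
  linarith

end AlmostDominated

section OrderInterval

variable {E : Type*} [AddCommGroup E] [Lattice E] [IsOrderedAddMonoid E]

theorem le_sup_sub_nsmul_of_forall_le_abs {c d w : E} (hc : 0 ≤ c) (hw : 0 ≤ w) (n : ℕ)
    (hd : ∀ k ≤ n, d ≤ |c - k • w|) : d ≤ w ⊔ (c - n • w) := by
  induction n with
  | zero =>
    rw [zero_nsmul, sub_zero]
    exact (hd 0 le_rfl).trans (by rw [zero_nsmul, sub_zero, abs_of_nonneg hc]; exact le_sup_right)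
  | succ n ih =>
    set e := c - (n + 1) • w with he
    have h_ih : d ≤ w ⊔ (e + w) := by
      simpa only [he, succ_nsmul, sub_add_eq_sub_sub, sub_add_cancel] using
        ih fun k hk => hd k (hk.trans n.le_succ)
    have h_neg : (e + w) ⊓ -e ≤ w :=
      calc (e + w) ⊓ -e ≤ (e + w) ⊓ (-e + w) := inf_le_inf_left _ (le_add_of_nonneg_right hw)
        _ = (e ⊓ -e) + w := (inf_add _ _ _).symm
        _ = -|e| + w := by rw [abs, neg_sup, neg_neg, inf_comm]
        _ ≤ w := add_le_of_nonpos_left (neg_nonpos.2 (abs_nonneg e))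
    let _ : DistribLattice E := AddCommGroup.toDistribLattice E
    calc d ≤ (w ⊔ (e + w)) ⊓ |e| := le_inf h_ih (hd (n + 1) le_rfl)
      _ = (w ⊓ |e|) ⊔ ((e + w) ⊓ (e ⊔ -e)) := inf_sup_right _ _ _
      _ = (w ⊓ |e|) ⊔ (((e + w) ⊓ e) ⊔ ((e + w) ⊓ -e)) := by rw [inf_sup_left (e + w)]
      _ ≤ w ⊔ e := sup_le (inf_le_left.trans le_sup_left)
          (sup_le (inf_le_right.trans le_sup_right) (h_neg.trans le_sup_left))

/-- The sum is the midpoint convexity defect at `x`, `y` of `z ↦ ∑ k, |z - k • w|`; thus this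
function is uniformly convex on `[0, n • w]`, up to an error of order `w`. -/
theorem abs_sub_le_sum_add {w x y : E} {n : ℕ} (hw : 0 ≤ w) (hx : x ∈ Icc 0 (n • w))
    (hy : y ∈ Icc 0 (n • w)) :
    |x - y| ≤
      ∑ k ∈ Finset.range (n + 1), (|x - k • w| + |y - k • w| - |x + y - k • (w + w)|)
        + (w + w) := by
  set D : ℕ → E := fun k => |x - k • w| + |y - k • w| - |x + y - k • (w + w)|
  have hD (k : ℕ) : 0 ≤ D k := by
    rw [sub_nonneg, nsmul_add, add_sub_add_comm]
    exact abs_add_le _ _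
  rw [← sub_le_iff_le_add']
  have h_le := le_sup_sub_nsmul_of_forall_le_abs (d := |x - y| - ∑ k ∈ Finset.range (n + 1), D k)
    (add_nonneg hx.1 hy.1) (add_nonneg hw hw) n fun k hk => by
      have hDk := Finset.single_le_sum (fun i _ => hD i) (Finset.mem_range.2 (Nat.lt_succ_of_le hk))
      calc |x - y| - ∑ k ∈ Finset.range (n + 1), D k
          ≤ (|x - k • w| + |y - k • w|) - D k := by
            refine sub_le_sub ?_ hDk
            simpa only [abs_neg, ← sub_eq_add_neg, sub_sub_sub_cancel_right] using
              abs_add_le (x - k • w) (-(y - k • w))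
        _ = |x + y - k • (w + w)| := sub_sub_cancel _ _
  refine h_le.trans (sup_le le_rfl ?_)
  rw [nsmul_add]
  exact (sub_nonpos.2 (add_le_add hx.2 hy.2)).trans (add_nonneg hw hw)

end OrderInterval

section Compactness

theorem exists_forall_convex_exists_add_sub_midpoint_le {F : Type*} [AddCommGroup F] [Module ℝ F]
    {C : Set F} (hC : Convex ℝ C) {l : Filter F} [l.NeBot] (hl : C ∈ l) {Ψ : F → ℝ} {a b : ℝ}
    (hΨ : ∀ x ∈ C, Ψ x ∈ Icc a b) {δ : ℝ} (hδ : 0 < δ) :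
    ∃ c ∈ C, ∀ U ∈ l, Convex ℝ U → ∃ x ∈ U ∩ C, Ψ x + Ψ c - 2 * Ψ (midpoint ℝ x c) ≤ δ := by
  -- `sSup R` is the limit inferior of `Ψ` along the convex members of `l`.
  let R : Set ℝ := {r | ∃ U ∈ l, Convex ℝ U ∧ U ⊆ C ∧ ∀ x ∈ U, r ≤ Ψ x}
  have hR_ne : R.Nonempty := ⟨a, C, hl, hC, subset_rfl, fun x hx => (hΨ x hx).1⟩
  have hR_bdd : BddAbove R := by
    refine ⟨b, ?_⟩
    rintro r ⟨U, hU, -, hUC, hr⟩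
    obtain ⟨x, hx⟩ := Filter.nonempty_of_mem hU
    exact (hr x hx).trans (hΨ x (hUC hx)).2
  obtain ⟨r, ⟨V, hV, hV_conv, hVC, hr⟩, hrR⟩ :=
    exists_lt_of_lt_csSup hR_ne (sub_lt_self (sSup R) (by positivity : 0 < δ / 4))
  have h_small (U : Set F) (hU : U ∈ l) (hU_conv : Convex ℝ U) :
      ∃ x ∈ U ∩ V, Ψ x < sSup R + δ / 4 := by
    by_contra! h_large
    have h_mem : sSup R + δ / 4 ∈ R :=
      ⟨U ∩ V, inter_mem hU hV, hU_conv.inter hV_conv, inter_subset_right.trans hVC, h_large⟩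
    linarith [le_csSup hR_bdd h_mem]
  obtain ⟨c, hc, hcR⟩ := h_small V hV hV_conv
  refine ⟨c, hVC hc.1, fun U hU hU_conv => ?_⟩
  obtain ⟨x, hx, hxR⟩ := h_small U hU hU_conv
  have h_mid := hr _ (hV_conv.midpoint_mem hx.2 hc.1)
  exact ⟨x, ⟨hx.1, hVC hx.2⟩, by linarith⟩

theorem mem_range_of_forall_exists_norm_sub_le {X Z : Type*} [NormedAddCommGroup X]
    [NormedSpace ℝ X] [CompleteSpace X] [NormedAddCommGroup Z] [NormedSpace ℝ Z]
    (J : X →ₗᵢ[ℝ] Z) {z : Z}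
    (hz : ∀ ε > 0, ∃ x, ‖z - J x‖ ≤ ε) : z ∈ range J := by
  refine J.isometry.isClosedEmbedding.isClosed_range.closure_subset
    (Metric.mem_closure_range_iff.2 fun ε hε => ?_)
  obtain ⟨x, hx⟩ := hz (ε / 2) (half_pos hε)
  exact ⟨x, (dist_eq_norm _ _).trans_lt (hx.trans_lt (half_lt_self hε))⟩

variable {E : Type*} [NormedAddCommGroup E] [NormedSpace ℝ E] [Lattice E] [IsOrderedAddMonoid E]
  {Y : Type*} [NormedAddCommGroup Y] [NormedSpace ℝ Y]

theorem AlmostDominated.exists_forall_norm_apply_le {T : E →L[ℝ] Y} (hT : AlmostDominated T)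
    {ε : ℝ} (hε : 0 < ε) {v : E} (hv : 0 ≤ v) :
    ∃ g : StrongDual ℝ E, Monotone g ∧ ∀ x, |x| ≤ v → ‖T x‖ ≤ g |x| + ε := by
  obtain ⟨g, hg, hTg⟩ := hT (ε / 2) (half_pos hε) v hv
  refine ⟨g, hg, fun x hx => ?_⟩
  have h_pos := hTg x⁺ ⟨posPart_nonneg x, (sup_le (le_abs_self x) (abs_nonneg x)).trans hx⟩
  have h_neg := hTg x⁻ ⟨negPart_nonneg x, (sup_le (neg_le_abs x) (abs_nonneg x)).trans hx⟩
  calc ‖T x‖ = ‖T x⁺ - T x⁻‖ := by rw [← map_sub, posPart_sub_negPart]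
    _ ≤ ‖T x⁺‖ + ‖T x⁻‖ := norm_sub_le _ _
    _ ≤ g x⁺ + g x⁻ + ε := by linarith
    _ = g |x| + ε := by rw [← map_add, posPart_add_negPart]

variable [IsOrderedModule ℝ E]

theorem apply_abs_sub_le_sum_midpoint {g : StrongDual ℝ E} (hg : Monotone g) {w x y : E} {n : ℕ}
    (hw : 0 ≤ w) (hx : x ∈ Icc 0 (n • w)) (hy : y ∈ Icc 0 (n • w)) :
    g |x - y| ≤ ∑ k ∈ Finset.range (n + 1), g |x - k • w|
      + ∑ k ∈ Finset.range (n + 1), g |y - k • w|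
      - 2 * ∑ k ∈ Finset.range (n + 1), g |midpoint ℝ x y - k • w| + 2 * g w := by
  have h_mid (k : ℕ) : g |x + y - k • (w + w)| = 2 * g |midpoint ℝ x y - k • w| := by
    rw [← smul_eq_mul, ← map_smul, ← abs_smul_of_pos two_pos, two_smul, sub_add_sub_comm,
      midpoint_add_self, nsmul_add]
  refine (hg (abs_sub_le_sum_add hw hx hy)).trans_eq ?_
  simp only [map_add, map_sum, map_sub, h_mid, Finset.sum_sub_distrib, Finset.sum_add_distrib,
    Finset.mul_sum]
  ring

/-- In the `L¹`-seminorm `x ↦ g |x|`, order intervals are weakly compact. -/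
theorem exists_mem_Icc_forall_convex_exists_apply_abs_sub_le {g : StrongDual ℝ E}
    (hg : Monotone g) {v : E} (hv : 0 ≤ v) {l : Filter E} [l.NeBot] (hl : Icc 0 v ∈ l)
    {δ : ℝ} (hδ : 0 < δ) :
    ∃ a ∈ Icc 0 v, ∀ U ∈ l, Convex ℝ U → ∃ x ∈ U ∩ Icc 0 v, g |x - a| ≤ δ := by
  have h_nonneg {x : E} (hx : 0 ≤ x) : 0 ≤ g x := (map_zero g).ge.trans (hg hx)
  obtain ⟨n, hn⟩ := exists_nat_gt (4 * g v / δ)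
  have hn₀ : (0 : ℝ) < n :=
    lt_of_le_of_lt (div_nonneg (mul_nonneg four_pos.le (h_nonneg hv)) hδ.le) hn
  set w := (n : ℝ)⁻¹ • v with hw_def
  have hw : 0 ≤ w := smul_nonneg (by positivity) hv
  have hnw : n • w = v := by rw [← Nat.cast_smul_eq_nsmul ℝ, smul_inv_smul₀ hn₀.ne']
  have hgw : 4 * g w ≤ δ := by
    rw [hw_def, map_smul, smul_eq_mul, mul_left_comm, inv_mul_le_iff₀ hn₀]
    exact ((div_lt_iff₀ hδ).1 hn).le
  have h_bdd (x : E) (hx : x ∈ Icc 0 v) :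
      ∑ k ∈ Finset.range (n + 1), g |x - k • w| ∈ Icc 0 ((n + 1) • g v) := by
    refine ⟨Finset.sum_nonneg fun k _ => h_nonneg (abs_nonneg _), ?_⟩
    refine (Finset.sum_le_card_nsmul _ _ (g v) fun k hk => hg ?_).trans_eq
      (by rw [Finset.card_range])
    have hkw : k • w ≤ v :=
      hnw ▸ nsmul_le_nsmul_left hw (Nat.lt_succ_iff.1 (Finset.mem_range.1 hk))
    refine abs_le'.2 ⟨(sub_le_self _ (nsmul_nonneg hw k)).trans hx.2, ?_⟩
    rw [neg_sub]
    exact (sub_le_self _ hx.1).trans hkw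
  obtain ⟨a, ha, h_close⟩ :=
    exists_forall_convex_exists_add_sub_midpoint_le (convex_Icc 0 v) hl h_bdd (half_pos hδ)
  refine ⟨a, ha, fun U hU hU_conv => ?_⟩
  obtain ⟨x, hx, hxa⟩ := h_close U hU hU_conv
  have h_conv := apply_abs_sub_le_sum_midpoint hg hw (hnw.symm ▸ hx.2) (hnw.symm ▸ ha)
  exact ⟨x, hx, by linarith⟩

theorem AlmostDominated.exists_mem_Icc_forall_convex_exists_norm_apply_sub_le {T : E →L[ℝ] Y}
    (hT : AlmostDominated T) {v : E} (hv : 0 ≤ v) {l : Filter E} [l.NeBot] (hl : Icc 0 v ∈ l)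
    {ε : ℝ} (hε : 0 < ε) :
    ∃ a ∈ Icc 0 v, ∀ U ∈ l, Convex ℝ U → ∃ x ∈ U ∩ Icc 0 v, ‖T (x - a)‖ ≤ ε := by
  obtain ⟨g, hg, hTg⟩ := hT.exists_forall_norm_apply_le (half_pos hε) hv
  obtain ⟨a, ha, h_close⟩ :=
    exists_mem_Icc_forall_convex_exists_apply_abs_sub_le hg hv hl (half_pos hε)
  refine ⟨a, ha, fun U hU hU_conv => ?_⟩
  obtain ⟨x, hx, hxa⟩ := h_close U hU hU_conv
  have h_abs : |x - a| ≤ v := abs_le'.2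
    ⟨(sub_le_self _ ha.1).trans hx.2.2, neg_sub x a ▸ (sub_le_self _ hx.2.1).trans ha.2⟩
  exact ⟨x, hx, by linarith [hTg _ h_abs]⟩

theorem AlmostDominated.mem_range_inclusionInDoubleDual [CompleteSpace Y] {T : E →L[ℝ] Y}
    (hT : AlmostDominated T) {v : E} (hv : 0 ≤ v) {l : Filter E} [l.NeBot] (hl : Icc 0 v ∈ l)
    {L : StrongDual ℝ (StrongDual ℝ Y)}
    (hL : ∀ f : StrongDual ℝ Y, Tendsto (fun x => f (T x)) l (𝓝 (L f))) :
    L ∈ range (NormedSpace.inclusionInDoubleDual ℝ Y) := by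
  refine mem_range_of_forall_exists_norm_sub_le (Z := StrongDual ℝ (StrongDual ℝ Y))
    (NormedSpace.inclusionInDoubleDualLi ℝ (E := Y)) fun ε hε => ?_
  obtain ⟨a, -, h_close⟩ :=
    hT.exists_mem_Icc_forall_convex_exists_norm_apply_sub_le hv hl hε
  refine ⟨T a, ContinuousLinearMap.opNorm_le_bound _ hε.le fun f => ?_⟩
  refine le_of_forall_pos_le_add fun η hη => ?_
  have h_conv : Convex ℝ {x | f (T x) ∈ Metric.closedBall (L f) η} :=
    (convex_closedBall (L f) η).linear_preimage ((f.comp T : E →L[ℝ] ℝ) : E →ₗ[ℝ] ℝ)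
  obtain ⟨x, hx, hxa⟩ := h_close _ (hL f (Metric.closedBall_mem_nhds _ hη)) h_conv
  have hLx : ‖L f - f (T x)‖ ≤ η := by
    rw [← dist_eq_norm, dist_comm]
    exact hx.1
  have h_fxa : ‖f (T x) - f (T a)‖ ≤ ε * ‖f‖ := by
    rw [← map_sub, ← map_sub, mul_comm]
    exact f.le_opNorm_of_le hxa
  calc ‖L f - f (T a)‖ ≤ ‖L f - f (T x)‖ + ‖f (T x) - f (T a)‖ :=
        norm_sub_le_norm_sub_add_norm_sub _ _ _
    _ ≤ ε * ‖f‖ + η := by linarith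

theorem AlmostDominated.orderWeaklyCompact [HasSolidNorm E] [CompleteSpace Y] {T : E →L[ℝ] Y}
    (hT : AlmostDominated T) : OrderWeaklyCompact T := by
  intro v hv
  refine NormedSpace.isCompact_closure_of_isBounded ℝ Y _ ?_ fun L hL => ?_
  · rw [(toWeakSpace ℝ Y).injective.preimage_image]
    refine (isBounded_iff_forall_norm_le).2 ⟨‖T‖ * ‖v‖, ?_⟩
    rintro _ ⟨x, hx, rfl⟩
    exact norm_apply_le_of_mem_Icc T hx
  · set J := NormedSpace.inclusionInDoubleDualWeak ℝ Y
    rw [image_image, image_image, mem_closure_iff_clusterPt, ← map_principal] at hL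
    let Φ : E → WeakDual ℝ (StrongDual ℝ Y) := fun x => J (toWeakSpace ℝ Y (T x))
    have : (𝓟 (Icc 0 v) ⊓ comap Φ (𝓝 L)).NeBot :=
      neBot_inf_comap_iff_map.2 (by rwa [inf_comm])
    obtain ⟨y, hy⟩ := hT.mem_range_inclusionInDoubleDual hv
      (mem_inf_of_left (mem_principal_self (Icc 0 v)) : _ ∈ 𝓟 (Icc 0 v) ⊓ comap Φ (𝓝 L))
      (L := WeakDual.toStrongDual L) fun f =>
        ((WeakDual.eval_continuous f).tendsto L).comp (tendsto_comap.mono_left inf_le_right)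
    exact ⟨toWeakSpace ℝ Y y, WeakDual.toStrongDual.injective hy⟩

end Compactness

section UawConvergence

theorem tendsto_toWeakSpace_zero_iff {X α : Type*} [NormedAddCommGroup X] [NormedSpace ℝ X]
    {l : Filter α} {x : α → X} :
    Tendsto (fun a => toWeakSpace ℝ X (x a)) l (𝓝 0) ↔
      ∀ f : StrongDual ℝ X, Tendsto (fun a => f (x a)) l (𝓝 0) := by
  have h_inj : Function.Injective (topDualPairing ℝ X).flip := fun a b hab =>
    (SeparatingDual.eq_iff_forall_dual_eq (R := ℝ)).2 (LinearMap.congr_fun hab)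
  rw [← map_zero (toWeakSpace ℝ X)]
  refine (WeakBilin.tendsto_iff_forall_eval_tendsto _ h_inj).trans (forall_congr' fun f => ?_)
  rw [← map_zero f]
  rfl

variable {E : Type u} [NormedAddCommGroup E] [NormedSpace ℝ E] [Lattice E] {ι κ : Type*}
  {l : Filter ι} {x y : ι → E} {a v : E}

theorem uawTendsto_zero_iff :
    UawTendsto x l 0 ↔ ∀ u : E, 0 ≤ u → ∀ f : StrongDual ℝ E,
      Tendsto (fun i => f (|x i| ⊓ u)) l (𝓝 0) := by
  simp only [UawTendsto, sub_zero, tendsto_toWeakSpace_zero_iff]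

theorem UawTendsto.comp (h : UawTendsto x l a) {l' : Filter κ} {φ : κ → ι}
    (hφ : Tendsto φ l' l) : UawTendsto (x ∘ φ) l' a :=
  fun u hu => (h u hu).comp hφ

theorem UawTendsto.sub_const (h : UawTendsto x l a) : UawTendsto (fun i => x i - a) l 0 := by
  simpa only [UawTendsto, sub_zero] using h

variable [IsOrderedAddMonoid E]

theorem uawTendsto_of_forall_eq (h : ∀ i, x i = a) : UawTendsto x l a := by
  intro u hu
  simp only [h, sub_self, abs_zero, inf_eq_left.2 hu, map_zero]
  exact tendsto_const_nhds

theorem HasSubnetUawTendsto.of_frequently_eq {ι : Type u} [Preorder ι] [IsDirectedOrder ι]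
    [Nonempty ι] {x : ι → E} (h : ∃ᶠ i in atTop, x i = a) : HasSubnetUawTendsto x a := by
  rw [frequently_atTop] at h
  refine ⟨{i // x i = a}, inferInstance, ⟨?_⟩, ?_, Subtype.val, ?_,
    uawTendsto_of_forall_eq Subtype.prop⟩
  · rintro ⟨i, _⟩ ⟨j, _⟩
    obtain ⟨k, hik, hjk⟩ := exists_ge_ge i j
    obtain ⟨m, hkm, hm⟩ := h k
    exact ⟨⟨m, hm⟩, hik.trans hkm, hjk.trans hkm⟩
  · obtain ⟨m, -, hm⟩ := h (Classical.arbitrary ι)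
    exact ⟨⟨m, hm⟩⟩
  · refine tendsto_atTop.2 fun i => ?_
    obtain ⟨m, him, hm⟩ := h i
    filter_upwards [Ici_mem_atTop (⟨m, hm⟩ : {i // x i = a})] with k hk using him.trans hk

theorem UawTendsto.of_eventually_ne {z : ℕ → E} (hz : UawTendsto z atTop 0)
    (hx : ∀ i, x i ∈ insert 0 (range z)) (hxz : ∀ n, ∀ᶠ i in l, x i ≠ z n) :
    UawTendsto x l 0 := by
  intro u hu W hW
  obtain ⟨N, hN⟩ := mem_atTop_sets.1 (hz u hu hW)
  rw [mem_map]
  filter_upwards [(Finset.eventually_all (Finset.range N)).2 fun n _ => hxz n] with i hi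
  rcases hx i with h_zero | ⟨n, hn⟩
  · rw [mem_preimage, h_zero, sub_zero, abs_zero, inf_eq_left.2 hu, map_zero]
    exact mem_of_mem_nhds hW
  · rw [mem_preimage, ← hn]
    exact hN n (not_lt.1 fun hlt => hi n (Finset.mem_range.2 hlt) hn.symm)

theorem uawCompact_insert_zero_range {z : ℕ → E} (hz : UawTendsto z atTop 0) :
    UawCompact (insert 0 (range z)) := by
  intro ι _ _ _ x hx
  by_cases h_freq : ∃ a ∈ insert 0 (range z), ∃ᶠ i in atTop, x i = a
  · obtain ⟨a, ha, hxa⟩ := h_freq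
    exact ⟨a, ha, .of_frequently_eq hxa⟩
  · push Not at h_freq
    exact ⟨0, mem_insert _ _, ι, inferInstance, inferInstance, inferInstance, id, tendsto_id,
      hz.of_eventually_ne hx fun n => h_freq _ (mem_insert_of_mem _ (mem_range_self n))⟩

variable [IsOrderedModule ℝ E] [HasSolidNorm E]

theorem tendsto_dual_apply_of_abs_le
    (hy : ∀ g : StrongDual ℝ E, Monotone g → Tendsto (fun i => g (y i)) l (𝓝 0))
    (hxy : ∀ i, |x i| ≤ y i) (f : StrongDual ℝ E) : Tendsto (fun i => f (x i)) l (𝓝 0) := by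
  obtain ⟨g, hg, hfg, -⟩ := exists_monotone_abs_apply_le f
  exact squeeze_zero_norm (fun i => (hfg (x i)).trans (hg (hxy i))) (hy g hg)

theorem UawTendsto.of_abs_le (hy : UawTendsto y l 0) (hxy : ∀ i, |x i| ≤ |y i|) :
    UawTendsto x l 0 := by
  rw [uawTendsto_zero_iff] at hy ⊢
  intro u hu f
  refine tendsto_dual_apply_of_abs_le (fun g _ => hy u hu g) (fun i => ?_) f
  rw [abs_of_nonneg (le_inf (abs_nonneg _) hu)]
  exact inf_le_inf_right _ (hxy i)

theorem UawTendsto.tendsto_dual_apply (hx : UawTendsto x l 0) (hv : 0 ≤ v)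
    (hxv : ∀ i, |x i| ≤ v) (f : StrongDual ℝ E) : Tendsto (fun i => f (x i)) l (𝓝 0) :=
  tendsto_dual_apply_of_abs_le (fun g _ => uawTendsto_zero_iff.1 hx v hv g)
    (fun i => le_inf le_rfl (hxv i)) f

theorem OrderBoundedSeries.uawTendsto_zero {w : ℕ → E} (hw : OrderBoundedSeries w v) :
    UawTendsto w atTop 0 := by
  rw [uawTendsto_zero_iff]
  intro u hu
  refine tendsto_dual_apply_of_abs_le (y := w) (fun g hg => ?_) (fun n => ?_)
  · refine (summable_of_sum_le (c := g v) (fun n => ?_) fun s => ?_).tendsto_atTop_zero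
    · exact (map_zero g).ge.trans (hg (hw.mem_Icc n).1)
    · rw [← map_sum]
      exact hg (hw.sum_mem_Icc s).2
  · have hwn := (hw.mem_Icc n).1
    rw [abs_of_nonneg hwn, abs_of_nonneg (le_inf hwn hu)]
    exact inf_le_left

end UawConvergence

section Operators

theorem isCompact_closure_of_forall_seq {X : Type*} [PseudoMetricSpace X] {s : Set X}
    (h : ∀ x : ℕ → X, (∀ n, x n ∈ s) → ∃ (a : X) (φ : ℕ → ℕ), StrictMono φ ∧
      Tendsto (x ∘ φ) atTop (𝓝 a)) : IsCompact (closure s) := by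
  refine IsSeqCompact.isCompact fun y hy => ?_
  choose z hz hyz using fun n : ℕ =>
    Metric.mem_closure_iff.1 (hy n) (1 / (n + 1 : ℝ)) Nat.one_div_pos_of_nat
  obtain ⟨a, φ, hφ, hφa⟩ := h z hz
  have h_dist : Tendsto (fun n => dist (z (φ n)) (y (φ n))) atTop (𝓝 0) := by
    refine squeeze_zero (fun n => dist_nonneg) (fun n => ?_)
      (tendsto_one_div_add_atTop_nhds_zero_nat.comp hφ.tendsto_atTop)
    rw [dist_comm]
    exact (hyz _).le
  have hya : Tendsto (y ∘ φ) atTop (𝓝 a) := (tendsto_iff_of_dist h_dist).1 hφa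
  exact ⟨a, isClosed_closure.mem_of_tendsto hya (Eventually.of_forall fun n => hy _), φ, hφ, hya⟩

theorem tendsto_uLift_down_atTop : Tendsto (ULift.down : ULift.{u} ℕ → ℕ) atTop atTop :=
  tendsto_atTop.2 fun n => Ici_mem_atTop (⟨n⟩ : ULift.{u} ℕ)

theorem tendsto_uLift_up_atTop : Tendsto (ULift.up : ℕ → ULift.{u} ℕ) atTop atTop :=
  tendsto_atTop.2 fun n => Ici_mem_atTop n.down

variable {E : Type u} [NormedAddCommGroup E] [NormedSpace ℝ E] [Lattice E] [IsOrderedAddMonoid E]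
  {Y : Type*} [NormedAddCommGroup Y] [NormedSpace ℝ Y] {T : E →L[ℝ] Y}

theorem almostDominated_iff :
    AlmostDominated T ↔ ∀ ε : ℝ, 0 < ε → ∀ v : E, 0 ≤ v →
      ∃ g : StrongDual ℝ E, (∀ x : E, 0 ≤ x → 0 ≤ g x) ∧ ∃ u : E, 0 ≤ u ∧
        ∀ x ∈ Icc (-v) v, ‖T x‖ ≤ g (|x| ⊓ u) + ε := by
  refine ⟨fun hT ε hε v hv => ?_, fun hT ε hε v hv => ?_⟩
  · obtain ⟨g, hg, hTg⟩ := hT.exists_forall_norm_apply_le hε hv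
    refine ⟨g, fun x => (monotone_iff_map_nonneg g).1 hg x, v, hv, fun x hx => ?_⟩
    rw [mem_Icc_neg_iff_abs_le] at hx
    rw [inf_eq_left.2 hx]
    exact hTg x hx
  · obtain ⟨g, hg, u, -, hTg⟩ := hT ε hε v hv
    have hg_mono : Monotone g := (monotone_iff_map_nonneg g).2 hg
    refine ⟨g, hg_mono, fun x hx => ?_⟩
    refine (hTg x ⟨(neg_nonpos.2 hv).trans hx.1, hx.2⟩).trans
      (add_le_add_left (hg_mono ?_) ε)
    rw [abs_of_nonneg hx.1]
    exact inf_le_left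

theorem AlmostDominated.tendsto_apply (hT : AlmostDominated T) {A : Set E} (hA : OrderBounded A)
    {ι : Type*} {l : Filter ι} {x : ι → E} (hx : ∀ i, x i ∈ A) {a : E} (hxa : UawTendsto x l a) :
    Tendsto (fun i => T (x i)) l (𝓝 (T a)) := by
  obtain ⟨b, c, hbc⟩ := hA
  let v := |c - a| ⊔ |a - b|
  have hxv (i : ι) : |x i - a| ≤ v := by
    refine abs_le'.2 ⟨?_, ?_⟩
    · exact (sub_le_sub_right (hbc (hx i)).2 a).trans ((le_abs_self _).trans le_sup_left)
    · rw [neg_sub]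
      exact (sub_le_sub_left (hbc (hx i)).1 a).trans ((le_abs_self _).trans le_sup_right)
  rw [← tendsto_sub_nhds_zero_iff, Metric.tendsto_nhds]
  intro ε hε
  obtain ⟨g, -, hTg⟩ :=
    hT.exists_forall_norm_apply_le (half_pos hε) ((abs_nonneg (c - a)).trans le_sup_left : 0 ≤ v)
  have h_lim := uawTendsto_zero_iff.1 hxa.sub_const v ((abs_nonneg (c - a)).trans le_sup_left) g
  filter_upwards [h_lim.eventually_lt_const (half_pos hε)] with i hi
  rw [inf_eq_left.2 (hxv i)] at hi
  rw [dist_zero_right, ← map_sub]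
  linarith [hTg _ (hxv i)]

theorem AlmostDominated.exists_strictMono_tendsto (hT : AlmostDominated T) {A : Set E}
    (hA : OrderBounded A) {x : ℕ → E} (hx : ∀ n, x n ∈ A) {a : E}
    (hxa : HasSubnetUawTendsto (fun n : ULift.{u} ℕ => x n.down) a) :
    ∃ φ : ℕ → ℕ, StrictMono φ ∧ Tendsto (fun n => T (x (φ n))) atTop (𝓝 (T a)) := by
  obtain ⟨κ, _, _, _, φ, hφ, hφa⟩ := hxa
  have h_lim : Tendsto (fun k => T (x (φ k).down)) atTop (𝓝 (T a)) :=
    hT.tendsto_apply hA (fun k => hx (φ k).down) hφa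
  exact (MapClusterPt.of_comp (tendsto_uLift_down_atTop.comp hφ) (u := fun n => T (x n))
    h_lim.mapClusterPt).tendsto_subseq

theorem AlmostDominated.isCompact_image (hT : AlmostDominated T) {A : Set E}
    (hA : OrderBounded A) (hA_compact : UawCompact A) : IsCompact (T '' A) := by
  refine IsSeqCompact.isCompact fun y hy => ?_
  choose x hxA hxy using hy
  obtain rfl : (fun n => T (x n)) = y := funext hxy
  obtain ⟨a, ha, hxa⟩ := hA_compact (ULift.{u} ℕ) (fun n => x n.down) fun n => hxA _
  exact ⟨T a, mem_image_of_mem T ha, hT.exists_strictMono_tendsto hA hxA hxa⟩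

theorem AlmostDominated.isCompact_closure_image (hT : AlmostDominated T) {A : Set E}
    (hA : OrderBounded A) (hA_compact : RelativelyUawCompact A) :
    IsCompact (closure (T '' A)) := by
  refine isCompact_closure_of_forall_seq fun y hy => ?_
  choose x hxA hxy using hy
  obtain rfl : (fun n => T (x n)) = y := funext hxy
  obtain ⟨a, hxa⟩ := hA_compact (ULift.{u} ℕ) (fun n => x n.down) fun n => hxA _
  exact ⟨T a, hT.exists_strictMono_tendsto hA hxA hxa⟩

theorem sLWeaklyCompact_singleton_iff {v : E} (hv : 0 ≤ v) :
    SLWeaklyCompact {v} T ↔ ∀ x : ℕ → E, (∀ n, x n ∈ Icc (-v) v) → UawTendsto x atTop 0 →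
      Tendsto (fun n => T (x n)) atTop (𝓝 0) := by
  have h_mem (x : E) : x ∈ LatticeOrderedAddCommGroup.solidClosure {v} ↔ x ∈ Icc (-v) v := by
    rw [mem_Icc_neg_iff_abs_le]
    simp [LatticeOrderedAddCommGroup.solidClosure, abs_of_nonneg hv]
  simp only [SLWeaklyCompact, h_mem]

variable [IsOrderedModule ℝ E] [HasSolidNorm E]

theorem tendsto_apply_of_isCompact_closure_image
    (hT : ∀ A : Set E, OrderBounded A → UawCompact A → IsCompact (closure (T '' A)))
    {v : E} (hv : 0 ≤ v) {x : ℕ → E} (hxv : ∀ n, x n ∈ Icc (-v) v) (hx : UawTendsto x atTop 0) :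
    Tendsto (fun n => T (x n)) atTop (𝓝 0) := by
  have h_bdd : OrderBounded (insert 0 (range x)) :=
    ⟨-v, v, insert_subset ⟨neg_nonpos.2 hv, hv⟩ (range_subset_iff.2 hxv)⟩
  refine tendsto_of_subseq_tendsto fun φ hφ => ?_
  obtain ⟨y, -, ψ, hψ, hψy⟩ :=
    (hT _ h_bdd (uawCompact_insert_zero_range hx)).tendsto_subseq (x := fun n => T (x (φ n)))
      fun n => subset_closure (mem_image_of_mem _ (mem_insert_of_mem _ (mem_range_self _)))
  have hy : y = 0 := by
    refine (SeparatingDual.eq_iff_forall_dual_eq (R := ℝ)).2 fun f => ?_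
    rw [map_zero]
    have h_weak := hx.tendsto_dual_apply hv (fun n => mem_Icc_neg_iff_abs_le.1 (hxv n)) (f.comp T)
    exact tendsto_nhds_unique ((f.continuous.tendsto y).comp hψy)
      (h_weak.comp (hφ.comp hψ.tendsto_atTop))
  exact ⟨ψ, hy ▸ hψy⟩

theorem sLWeaklyCompact_of_isCompact_closure (hT : ∀ v : E, 0 ≤ v → SLWeaklyCompact {v} T)
    {S : Set E} (hS : IsCompact (closure S)) : SLWeaklyCompact S T := by
  intro x hxS hx
  choose y hyS hxy using hxS
  refine tendsto_of_subseq_tendsto fun φ hφ => ?_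
  obtain ⟨a, -, ψ, hψ, hψa⟩ := hS.tendsto_subseq (x := y ∘ φ) fun n => subset_closure (hyS _)
  refine ⟨ψ, ?_⟩
  choose z hza hzx hxz using fun n =>
    exists_abs_le_and_abs_sub_le_posPart (x (φ (ψ n))) (abs_nonneg a)
  have hTz : Tendsto (fun n => T (z n)) atTop (𝓝 0) :=
    hT |a| (abs_nonneg a) z (fun n => ⟨|a|, rfl, (hza n).trans (abs_abs a).ge⟩)
      ((hx.comp (hφ.comp hψ.tendsto_atTop)).of_abs_le hzx)
  have h_sub : Tendsto (fun n => x (φ (ψ n)) - z n) atTop (𝓝 0) := by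
    refine squeeze_zero_norm (fun n => norm_le_norm_of_abs_le_abs ?_)
      (tendsto_iff_norm_sub_tendsto_zero.1 hψa)
    refine (hxz n).trans (posPart_sub_le_of_le (abs_nonneg _) ((hxy _).trans ?_))
    simpa only [Function.comp_apply, add_sub_cancel] using abs_add_le a (y (φ (ψ n)) - a)
  simpa only [map_sub, sub_add_cancel, Function.comp_def, map_zero, add_zero] using
    ((T.continuous.tendsto 0).comp h_sub).add hTz

end Operators

theorem theorem3p12_general
    {E : Type u} [NormedAddCommGroup E] [NormedSpace ℝ E]
    [Lattice E] [IsOrderedAddMonoid E] [IsOrderedModule ℝ E] [HasSolidNorm E]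
    {Y : Type v} [NormedAddCommGroup Y] [NormedSpace ℝ Y] [CompleteSpace Y]
    (T : E →L[ℝ] Y) :
    [ OrderWeaklyCompact T,
      ∀ S : Set E, IsCompact (closure S) → SLWeaklyCompact S T,
      ∀ v : E, 0 ≤ v → SLWeaklyCompact {v} T,
      ∀ ε : ℝ, 0 < ε → ∀ v : E, 0 ≤ v →
        ∃ g : StrongDual ℝ E, (∀ x : E, 0 ≤ x → 0 ≤ g x) ∧ ∃ u : E, 0 ≤ u ∧
          ∀ x ∈ Icc (-v) v, ‖T x‖ ≤ g (|x| ⊓ u) + ε,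
      ∀ v : E, 0 ≤ v → ∀ (ι : Type w) [Preorder ι] [IsDirectedOrder ι] [Nonempty ι] (x : ι → E),
        (∀ i, x i ∈ Icc (-v) v) → UawTendsto x atTop 0 →
          Tendsto (fun i => T (x i)) atTop (𝓝 0),
      ∀ v : E, 0 ≤ v → ∀ x : ℕ → E,
        (∀ n, x n ∈ Icc (-v) v) → UawTendsto x atTop 0 →
          Tendsto (fun n => T (x n)) atTop (𝓝 0),
      ∀ A : Set E, OrderBounded A → UawCompact A → IsCompact (T '' A),
      ∀ A : Set E, OrderBounded A → RelativelyUawCompact A → IsCompact (closure (T '' A))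
    ].TFAE := by
  rw [← almostDominated_iff]
  tfae_have 1 → 4 := fun hT => almostDominated_of_tendsto_of_orderBoundedSeries fun v w hw =>
    hT.tendsto_apply_of_orderBoundedSeries hw
  tfae_have 4 → 1 := AlmostDominated.orderWeaklyCompact
  tfae_have 2 → 3 := fun hT v _ => hT {v} (by rw [closure_singleton]; exact isCompact_singleton)
  tfae_have 3 → 2 := fun hT S hS => sLWeaklyCompact_of_isCompact_closure hT hS
  tfae_have 3 ↔ 6 := forall₂_congr fun v hv => sLWeaklyCompact_singleton_iff hv
  tfae_have 4 → 5 := fun hT v _ ι _ _ _ x hxv hx => by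
    simpa only [map_zero] using hT.tendsto_apply ⟨-v, v, subset_rfl⟩ hxv hx
  tfae_have 5 → 6 := fun hT v hv x hxv hx =>
    (hT v hv (ULift.{w} ℕ) (x ∘ ULift.down) (fun n => hxv _)
      (hx.comp tendsto_uLift_down_atTop)).comp tendsto_uLift_up_atTop
  tfae_have 6 → 4 := fun hT => almostDominated_of_tendsto_of_orderBoundedSeries fun v w hw =>
    hT v hw.zero_le w (fun n => Icc_subset_Icc_left (neg_nonpos.2 hw.zero_le) (hw.mem_Icc n))
      hw.uawTendsto_zero
  tfae_have 4 → 7 := fun hT A => hT.isCompact_image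
  tfae_have 4 → 8 := fun hT A => hT.isCompact_closure_image
  tfae_have 7 → 6 := fun hT v hv x hxv hx =>
    tendsto_apply_of_isCompact_closure_image (fun A hA hAc => (hT A hA hAc).closure) hv hxv hx
  tfae_have 8 → 6 := fun hT v hv x hxv hx => tendsto_apply_of_isCompact_closure_image
    (fun A hA hAc => hT A hA fun ι _ _ _ y hy => (hAc ι y hy).imp fun _ => And.right) hv hxv hx
  tfae_finish

theorem theorem3p12
    {E : Type u} [NormedAddCommGroup E] [NormedSpace ℝ E] [CompleteSpace E]
    [Lattice E] [IsOrderedAddMonoid E] [IsOrderedModule ℝ E] [HasSolidNorm E]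
    {Y : Type v} [NormedAddCommGroup Y] [NormedSpace ℝ Y] [CompleteSpace Y]
    (T : E →L[ℝ] Y) :
    [ OrderWeaklyCompact T,
      ∀ S : Set E, IsCompact (closure S) → SLWeaklyCompact S T,
      ∀ v : E, 0 ≤ v → SLWeaklyCompact {v} T,
      ∀ ε : ℝ, 0 < ε → ∀ v : E, 0 ≤ v →
        ∃ g : StrongDual ℝ E, (∀ x : E, 0 ≤ x → 0 ≤ g x) ∧ ∃ u : E, 0 ≤ u ∧
          ∀ x ∈ Icc (-v) v, ‖T x‖ ≤ g (|x| ⊓ u) + ε,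
      ∀ v : E, 0 ≤ v → ∀ (ι : Type w) [Preorder ι] [IsDirectedOrder ι] [Nonempty ι] (x : ι → E),
        (∀ i, x i ∈ Icc (-v) v) → UawTendsto x atTop 0 →
          Tendsto (fun i => T (x i)) atTop (𝓝 0),
      ∀ v : E, 0 ≤ v → ∀ x : ℕ → E,
        (∀ n, x n ∈ Icc (-v) v) → UawTendsto x atTop 0 →
          Tendsto (fun n => T (x n)) atTop (𝓝 0),
      ∀ A : Set E, OrderBounded A → UawCompact A → IsCompact (T '' A),
      ∀ A : Set E, OrderBounded A → RelativelyUawCompact A → IsCompact (closure (T '' A))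
    ].TFAE :=
  theorem3p12_general T
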